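/- Fix infinite sets $\mathcal{X}$ of candidates and $\mathcal{V}$ of voters. A \emph{profile} $\mathbf{P}$ consists of a finite set $V(\mathbf{P})\subseteq\mathcal{V}$, a finite set $X(\mathbf{P})\subseteq\mathcal{X}$, and, for each $i\in V(\mathbf{P})$, a strict linear order $\mathbf{P}(i)$ on $X(\mathbf{P})$. The \emph{margin} of $x$ over $y$ in $\mathbf{P}$ is the number of voters ranking $x$ above $y$ minus the number ranking $y$ above $x$. For a set $A$ of candidates, $\mathbf{P}|_A$ is the profile with the same voters, each ballot being restricted to $X(\mathbf{P})\cap A$, and $\mathbf{P}_{-y}=\mathbf{P}|_{X(\mathbf{P})\setminus\{y\}}$. For voters $i,j\in\mathcal{V}$, $\mathbf{P}^{i\leftrightarrows j}$ is the profile obtained from $\mathbf{P}$ by exchanging the names $i$ and $j$; for candidates $a,b\in\mathcal{X}$, $\mathbf{P}_{a\leftrightarrows b}$ is the profile obtained by exchanging the names $a$ and $b$, and $S_{a\leftrightarrows b}$ is the image of a set $S\subseteq\mathcal{X}$ under the transposition of $a$ and $b$. A \emph{voting method} $F$ assigns to each profile $\mathbf{P}$ in a nonempty set $\mathrm{dom}(F)$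 of profiles a nonempty set $F(\mathbf{P})\subseteq X(\mathbf{P})$. Consider the following axioms, where all profiles that occur are assumed to belong to $\mathrm{dom}(F)$: - \emph{anonymity}: $F(\mathbf{P}^{i\leftrightarrows j})=F(\mathbf{P})$ for all $i,j\in\mathcal{V}$; - \emph{neutrality}: $F(\mathbf{P}_{a\leftrightarrows b})=F(\mathbf{P})_{a\leftrightarrows b}$ for all $a,b\in\mathcal{X}$; - \emph{binary quasi-resoluteness}: $|F(\mathbf{P})|=1$ whenever $|X(\mathbf{P})|=2$ and the margin of one candidate over the other is nonzero; - \emph{binary $\gamma$}: if $x\in F(\mathbf{P}_{-y})$ and $F(\mathbf{P}|_{\{x,y\}})=\{x\}$, then $x\in F(\mathbf{P})$; - \emph{$\alpha$-resoluteness}: if $x\in F(\mathbf{P}_{-y})$ and $F(\mathbf{P}|_{\{x,y\}})=\{x\}$, then $|F(\mathbf{P})|\le|F(\mathbf{P}_{-y})|$. Then: (a) There is no voting method with domain $\{\mathbf{P}\mid 1\le|X(\mathbf{P})|\le 6\}$ that satisfies anonymity, neutrality, binary quasi-resoluteness, binary $\gamma$, and $\alpha$-resoluteness. (b) There is a voting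 method with domain $\{\mathbf{P}\mid 1\le|X(\mathbf{P})|\le 5\}$ that satisfies all of these axioms. -/

import Mathlib

/-- A profile, with candidates drawn from `𝒳` and voters drawn from `𝒱`: a finite set of voters, a
finite set of candidates, and for each of the voters a strict linear order on the set of candidates.
`ranks i x y` says that `i` is one of the voters and that `i` ranks `x` above `y`. The relation
holds only for voters and candidates of the profile, so two profiles are equal exactly when they
have the same voters, the same candidates and the same ballots. -/
@[ext]
structure Profile (𝒳 : Type*) (𝒱 : Type*) where
  voters : Finset 𝒱
  cands : Finset 𝒳
  ranks : 𝒱 → 𝒳 → 𝒳 → Prop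
  mem_of_ranks : ∀ i x y, ranks i x y → i ∈ voters ∧ x ∈ cands ∧ y ∈ cands
  ranks_irrefl : ∀ i x, ¬ ranks i x x
  ranks_trans : ∀ i x y z, ranks i x y → ranks i y z → ranks i x z
  ranks_total : ∀ i ∈ voters, ∀ x ∈ cands, ∀ y ∈ cands, x ≠ y → ranks i x y ∨ ranks i y x

namespace Profile

variable {𝒳 : Type*} {𝒱 : Type*} [DecidableEq 𝒳] [DecidableEq 𝒱]

/-- The restriction `P|_A`: the same voters, each with their ballot restricted to `A`. -/
def restrict (P : Profile 𝒳 𝒱) (A : Finset 𝒳) : Profile 𝒳 𝒱 where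
  voters := P.voters
  cands := P.cands ∩ A
  ranks i x y := P.ranks i x y ∧ x ∈ A ∧ y ∈ A
  mem_of_ranks i x y h := by
    obtain ⟨hi, hx, hy⟩ := P.mem_of_ranks i x y h.1
    exact ⟨hi, Finset.mem_inter.2 ⟨hx, h.2.1⟩, Finset.mem_inter.2 ⟨hy, h.2.2⟩⟩
  ranks_irrefl i x h := P.ranks_irrefl i x h.1
  ranks_trans i x y z h₁ h₂ := ⟨P.ranks_trans i x y z h₁.1 h₂.1, h₁.2.1, h₂.2.2⟩
  ranks_total i hi x hx y hy hxy := by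
    rw [Finset.mem_inter] at hx hy
    exact (P.ranks_total i hi x hx.1 y hy.1 hxy).imp
      (fun h => ⟨h, hx.2, hy.2⟩) (fun h => ⟨h, hy.2, hx.2⟩)

/-- The profile `P_{-y}`, obtained by removing the candidate `y`. -/
def remove (P : Profile 𝒳 𝒱) (y : 𝒳) : Profile 𝒳 𝒱 :=
  P.restrict (P.cands.erase y)

open Classical in
/-- The margin of `x` over `y`: the number of voters who rank `x` above `y` minus the number of
voters who rank `y` above `x`. -/
noncomputable def margin (P : Profile 𝒳 𝒱) (x y : 𝒳) : ℤ :=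
  ((P.voters.filter fun i => P.ranks i x y).card : ℤ) -
    ((P.voters.filter fun i => P.ranks i y x).card : ℤ)

/-- The profile obtained from `P` by exchanging the voters `i` and `j`, which may or may not be
voters of `P`. -/
def swapVoters (P : Profile 𝒳 𝒱) (i j : 𝒱) : Profile 𝒳 𝒱 where
  voters := P.voters.map (Equiv.swap i j).toEmbedding
  cands := P.cands
  ranks k := P.ranks (Equiv.swap i j k)
  mem_of_ranks k x y h := by
    simpa [Finset.mem_map_equiv] using P.mem_of_ranks _ x y h
  ranks_irrefl k := P.ranks_irrefl _
  ranks_trans k := P.ranks_trans _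
  ranks_total k hk := P.ranks_total _ (by simpa [Finset.mem_map_equiv] using hk)

/-- The profile obtained from `P` by exchanging the candidates `a` and `b`, which may or may not be
candidates of `P`. -/
def swapCands (P : Profile 𝒳 𝒱) (a b : 𝒳) : Profile 𝒳 𝒱 where
  voters := P.voters
  cands := P.cands.map (Equiv.swap a b).toEmbedding
  ranks i x y := P.ranks i (Equiv.swap a b x) (Equiv.swap a b y)
  mem_of_ranks i x y h := by
    simpa [Finset.mem_map_equiv] using P.mem_of_ranks i _ _ h
  ranks_irrefl i x := P.ranks_irrefl i _
  ranks_trans i x y z := P.ranks_trans i _ _ _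
  ranks_total i hi x hx y hy hxy :=
    P.ranks_total i hi _ (by simpa [Finset.mem_map_equiv] using hx) _
      (by simpa [Finset.mem_map_equiv] using hy) (fun h => hxy ((Equiv.swap a b).injective h))

end Profile

/-- A voting method assigns to each profile `P` in a nonempty set `dom` of profiles a nonempty set
`winners P` of candidates of `P`. The values of `winners` outside `dom` carry no meaning, and every
axiom below looks at profiles in `dom` only. -/
structure VotingMethod (𝒳 : Type*) (𝒱 : Type*) where
  dom : Set (Profile 𝒳 𝒱)
  dom_nonempty : dom.Nonempty
  winners : Profile 𝒳 𝒱 → Finset 𝒳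
  winners_nonempty : ∀ P ∈ dom, (winners P).Nonempty
  winners_subset : ∀ P ∈ dom, winners P ⊆ P.cands

namespace VotingMethod

variable {𝒳 : Type*} {𝒱 : Type*} [DecidableEq 𝒳] [DecidableEq 𝒱]

/-- Exchanging two voters does not change the winners. -/
def Anonymity (F : VotingMethod 𝒳 𝒱) : Prop :=
  ∀ P ∈ F.dom, ∀ i j : 𝒱, P.swapVoters i j ∈ F.dom →
    F.winners (P.swapVoters i j) = F.winners P

/-- Exchanging two candidates exchanges them in the set of winners. -/
def Neutrality (F : VotingMethod 𝒳 𝒱) : Prop :=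
  ∀ P ∈ F.dom, ∀ a b : 𝒳, P.swapCands a b ∈ F.dom →
    F.winners (P.swapCands a b) = (F.winners P).map (Equiv.swap a b).toEmbedding

/-- There is a single winner whenever there are exactly two candidates and the margin of one over
the other is nonzero. -/
def BinaryQuasiResoluteness (F : VotingMethod 𝒳 𝒱) : Prop :=
  ∀ P ∈ F.dom, P.cands.card = 2 →
    (∀ x ∈ P.cands, ∀ y ∈ P.cands, x ≠ y → P.margin x y ≠ 0) → (F.winners P).card = 1

/-- If `x ∈ F(P_{-y})` and `F(P|_{x,y}) = {x}`, then `x ∈ F(P)`. -/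
def BinaryGamma (F : VotingMethod 𝒳 𝒱) : Prop :=
  ∀ P ∈ F.dom, ∀ x y : 𝒳, P.remove y ∈ F.dom → P.restrict {x, y} ∈ F.dom →
    x ∈ F.winners (P.remove y) → F.winners (P.restrict {x, y}) = {x} → x ∈ F.winners P

/-- If `x ∈ F(P_{-y})` and `F(P|_{x,y}) = {x}`, then `|F(P)| ≤ |F(P_{-y})|`. -/
def AlphaResoluteness (F : VotingMethod 𝒳 𝒱) : Prop :=
  ∀ P ∈ F.dom, ∀ x y : 𝒳, P.remove y ∈ F.dom → P.restrict {x, y} ∈ F.dom →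
    x ∈ F.winners (P.remove y) → F.winners (P.restrict {x, y}) = {x} →
      (F.winners P).card ≤ (F.winners (P.remove y)).card

end VotingMethod

/-- The set of all profiles with at least one and at most `n` candidates. -/
def profilesUpTo (𝒳 : Type*) (𝒱 : Type*) (n : ℕ) : Set (Profile 𝒳 𝒱) :=
  {P | P.cands.Nonempty ∧ P.cands.card ≤ n}

/-! Impossibility. Anonymity, neutrality and binary quasi-resoluteness reduce a voting method to an
isomorphism-invariant choice function on tournaments. The electorate is indexed by all permutations
of the candidates, so opposite opinions about a pair cancel except among the voters who place that
pair on top; these follow the tournament (`tournamentBallot`). Renaming candidates then only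
permutes voters. In each pair exactly one candidate wins, and by symmetry it is either always the
majority winner or always the majority loser; the second case becomes the first after reversing the
tournament.

For such a choice function, `no_equivariant_choice` plays the two remaining axioms against each
other: binary `γ` keeps a winner who beats the newcomer, and `α`-resoluteness then forbids the
number of winners to grow. Vertex-transitive subtournaments, where everyone must win, give the
starting points. The first tournament pins down a five-candidate subtournament with just two
winners. The second tournament contains a copy of it, hence has at most two winners, but also
contains a regular five-candidate tournament, which forces three.

Possibility. A choice depending only on the signs of the margins is automatically anonymous and
neutral. Up to four candidates it is given by explicit rules and a table. For five, precisely the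
candidates forced by binary `γ` are chosen, or everyone if there are none. The axioms become finite
statements about signs, the last and largest being `winsFive_of_pos`. -/

/-- Two six-candidate tournaments rule out every choice function on tournaments that is invariant
under isomorphism and satisfies binary `γ` and `α`-resoluteness. -/
theorem no_equivariant_choice
    (G : (Fin 6 → Fin 6 → Bool) → Finset (Fin 6) → Finset (Fin 6))
    (nonempty : ∀ T A, A.Nonempty → (G T A).Nonempty) (subset : ∀ T A, G T A ⊆ A)
    (iso : ∀ T T' A (σ : Equiv.Perm (Fin 6)),
      (∀ a ∈ A, ∀ b ∈ A, a ≠ b → T a b = T' (σ a) (σ b)) → G T' (A.map σ.toEmbedding) = (G T A).map σ.toEmbedding)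
    (gamma : ∀ T A a b, b ∈ A → a ∈ G T (A.erase b) → T a b = true → T b a = false → a ∈ G T A)
    (alpha : ∀ T A a b, b ∈ A → a ∈ G T (A.erase b) → T a b = true → T b a = false →
      (G T A).card ≤ (G T (A.erase b)).card) : False := by
  -- the first tournament: `5` beats everyone but `4`, and `4` beats everyone but `0`
  obtain ⟨T, hT⟩ : ∃ T : Fin 6 → Fin 6 → Bool, T = fun a b => decide (b ∈
    (![{4}, {0, 3}, {0, 1}, {0, 2}, {1, 2, 3, 5}, {0, 1, 2, 3}] : Fin 6 → Finset (Fin 6)) a) :=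
    ⟨_, rfl⟩
  -- the second tournament: removing `2` leaves a regular one
  obtain ⟨U, hU⟩ : ∃ U : Fin 6 → Fin 6 → Bool, U = fun a b => decide (b ∈
    (![{3, 4}, {0, 5}, {0, 1}, {1, 2, 5}, {1, 2, 3}, {0, 2, 4}] : Fin 6 → Finset (Fin 6)) a) :=
    ⟨_, rfl⟩
  -- an automorphism carries winners to winners
  have auto : ∀ (T : Fin 6 → Fin 6 → Bool) A (σ : Equiv.Perm (Fin 6)),
      A.map σ.toEmbedding = A → (∀ a ∈ A, ∀ b ∈ A, T a b = T (σ a) (σ b)) →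
      ∀ a ∈ G T A, σ a ∈ G T A := by
    intro T A σ hA h a ha
    have := iso T T A σ fun a ha b hb _ => h a ha b hb
    rw [hA] at this
    rw [this]
    exact Finset.mem_map_of_mem _ ha
  -- If the powers of one automorphism act transitively on `A`, everyone in `A` wins. The bound 5 on
  -- the exponent covers the orbits that occur and keeps transitivity decidable.
  have cyc : ∀ (T : Fin 6 → Fin 6 → Bool) A (σ : Equiv.Perm (Fin 6)),
      A.map σ.toEmbedding = A → (∀ a ∈ A, ∀ b ∈ A, T a b = T (σ a) (σ b)) →
      (∀ a ∈ A, ∀ b ∈ A, ∃ n < 5, (σ ^ n) a = b) → ∀ b ∈ A, b ∈ G T A := by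
    intro T A σ hA h ht b hb
    obtain ⟨a, ha⟩ := nonempty T A ⟨b, hb⟩
    obtain ⟨n, -, rfl⟩ := ht a (subset T A ha) b hb
    clear hb
    induction n with
    | zero => simpa using ha
    | succ n ih =>
      rw [pow_succ', Equiv.Perm.mul_apply]
      exact auto T A σ hA h _ ih
  have add : ∀ (T : Fin 6 → Fin 6 → Bool) A B a b, b ∈ A → A.erase b = B → T a b = true →
      T b a = false → a ∈ G T B → a ∈ G T A ∧ (G T A).card ≤ (G T B).card := by
    rintro T A _ a b hb rfl h₁ h₂ ha
    exact ⟨gamma T A a b hb ha h₁ h₂, alpha T A a b hb ha h₁ h₂⟩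
  -- The rotations follow the cycles 0 → 4 → 5 → 0 and 0 → 4 → 3 → 0 of `T`, and 0 → 4 → 3 → 1 → 5 →
  -- 0 of `U`.
  have c₁ := cyc T {0, 4, 5} (Equiv.swap 0 4 * Equiv.swap 4 5) (by decide)
    (by subst hT; decide) (by decide)
  have c₂ := cyc T {0, 3, 4} (Equiv.swap 0 4 * Equiv.swap 4 3) (by decide)
    (by subst hT; decide) (by decide)
  have c₃ := cyc U {0, 1, 3, 4, 5}
    (Equiv.swap 0 4 * Equiv.swap 4 3 * Equiv.swap 3 1 * Equiv.swap 1 5) (by decide)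
    (by subst hU; decide) (by decide)
  -- in the first tournament, `4` and `5` win
  have w : ∀ a, a = 4 ∨ a = 5 → a ∈ G T {0, 1, 2, 3, 4, 5} := by
    intro a ha
    have h₀ : a ∈ G T {0, 4, 5} := c₁ a (by rcases ha with rfl | rfl <;> decide)
    have e : ∀ b ∈ ({1, 2, 3} : Finset (Fin 6)), T a b = true ∧ T b a = false := by
      subst hT; rcases ha with rfl | rfl <;> decide
    have h₁ := (add T {0, 3, 4, 5} _ a 3 (by decide) (by decide) (e 3 (by decide)).1
      (e 3 (by decide)).2 h₀).1
    have h₂ := (add T {0, 2, 3, 4, 5} _ a 2 (by decide) (by decide) (e 2 (by decide)).1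
      (e 2 (by decide)).2 h₁).1
    exact (add T {0, 1, 2, 3, 4, 5} _ a 1 (by decide) (by decide) (e 1 (by decide)).1
      (e 1 (by decide)).2 h₂).1
  -- without `5`, the winners are `0` and `4`
  obtain ⟨m₁, b₁⟩ := add T {0, 2, 3, 4} _ 4 2 (by decide) (by decide) (by subst hT; decide)
    (by subst hT; decide) (c₂ 4 (by decide))
  obtain ⟨m₂, b₂⟩ := add T {0, 1, 2, 3, 4} _ 4 1 (by decide) (by decide) (by subst hT; decide)
    (by subst hT; decide) m₁
  have b₃ : (G T {0, 1, 2, 3, 4}).card ≤ 3 := by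
    have := Finset.card_le_card (subset T {0, 3, 4})
    have h3 : ({0, 3, 4} : Finset (Fin 6)).card = 3 := by decide
    omega
  have b₄ := (add T {0, 1, 2, 3, 4, 5} {0, 1, 2, 3, 4} 4 5 (by decide) (by decide)
    (by subst hT; decide) (by subst hT; decide) m₂).2
  have b₅ : 2 ≤ (G T {0, 1, 2, 3, 4, 5}).card := by
    have : ({4, 5} : Finset (Fin 6)) ⊆ G T {0, 1, 2, 3, 4, 5} := by
      intro a ha
      exact w a (by simpa using ha)
    simpa using Finset.card_le_card this
  -- The rotation 1 → 2 → 3 → 1 fixes 0 and 4, so 1, 2, 3 win together or not at all. Together with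
  -- 4 they would be four winners, against the bound of three; the lower bound of two then forces 0
  -- to win beside 4.
  have rot := auto T {0, 1, 2, 3, 4} (Equiv.swap 1 2 * Equiv.swap 2 3) (by decide)
    (by subst hT; decide)
  have e : G T {0, 1, 2, 3, 4} = {0, 4} := by
    have h₁ := rot 1
    have h₂ := rot 2
    have h₃ := rot 3
    have hs := subset T {0, 1, 2, 3, 4}
    revert hs h₁ h₂ h₃ m₂ b₃ b₄
    generalize G T {0, 1, 2, 3, 4} = S
    intro m₂ b₃ b₄
    have b₆ := b₅.trans b₄
    clear b₄ rot
    revert S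
    decide
  -- the same five-candidate tournament is left when `4` is removed from the second tournament
  have e' := iso T U {0, 1, 2, 3, 4} (Equiv.swap 3 4 * Equiv.swap 3 5) (by subst hT hU; decide)
  rw [e, show (({0, 1, 2, 3, 4} : Finset (Fin 6)).map
    (Equiv.swap 3 4 * Equiv.swap 3 5 : Equiv.Perm (Fin 6)).toEmbedding) = {0, 1, 2, 3, 5} by decide,
    show (({0, 4} : Finset (Fin 6)).map
    (Equiv.swap 3 4 * Equiv.swap 3 5 : Equiv.Perm (Fin 6)).toEmbedding) = {0, 3} by decide] at e'
  have b₇ := (add U {0, 1, 2, 3, 4, 5} {0, 1, 2, 3, 5} 0 4 (by decide) (by decide)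
    (by subst hU; decide) (by subst hU; decide) (by rw [e']; decide)).2
  rw [e'] at b₇
  -- Without 2 the tournament `U` is regular and everyone wins; 3, 4 and 5 beat 2, so they survive
  -- its return.
  have b₈ : ({3, 4, 5} : Finset (Fin 6)) ⊆ G U {0, 1, 2, 3, 4, 5} := by
    intro a ha
    refine (add U {0, 1, 2, 3, 4, 5} {0, 1, 3, 4, 5} a 2 (by decide) (by decide) ?_ ?_
      (c₃ a ?_)).1 <;> revert a <;> subst hU <;> decide
  have := Finset.card_le_card b₈
  have h3 : ({3, 4, 5} : Finset (Fin 6)).card = 3 := by decide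
  have h2 : ({0, 3} : Finset (Fin 6)).card = 2 := by decide
  omega

/-! ### Profiles built from permutations of positions -/

namespace Profile

variable {𝒳 : Type*} {𝒱 : Type*}

/-- The profile whose voters are the `e i`, whose candidates are the `c a` for `a ∈ A`, and in which
`e i` ranks the candidates by their positions under the permutation `r i`. -/
def ofPositions {I : Type*} [Fintype I] {n : ℕ} (e : I ↪ 𝒱) (c : Fin n ↪ 𝒳)
    (r : I → Equiv.Perm (Fin n)) (A : Finset (Fin n)) : Profile 𝒳 𝒱 where
  voters := Finset.univ.map e
  cands := A.map c
  ranks v x y := ∃ i a b, e i = v ∧ c a = x ∧ c b = y ∧ a ∈ A ∧ b ∈ A ∧ r i a < r i b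
  mem_of_ranks := by
    rintro _ _ _ ⟨i, a, b, rfl, rfl, rfl, ha, hb, -⟩
    exact ⟨by simp, by simpa using ha, by simpa using hb⟩
  ranks_irrefl := by
    rintro _ _ ⟨i, a, b, rfl, rfl, h, ha, hb, hab⟩
    rw [c.injective h] at hab
    exact lt_irrefl _ hab
  ranks_trans := by
    rintro _ _ _ _ ⟨i, a, b, rfl, rfl, rfl, ha, hb, hab⟩ ⟨i', b', d, hi, hb', rfl, -, hd, hbd⟩
    rw [e.injective hi, c.injective hb'] at hbd
    exact ⟨i, a, d, rfl, rfl, rfl, ha, hd, hab.trans hbd⟩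
  ranks_total := by
    simp only [Finset.mem_map, Finset.mem_univ, true_and]
    rintro _ ⟨i, rfl⟩ _ ⟨a, ha, rfl⟩ _ ⟨b, hb, rfl⟩ hab
    have hne : r i a ≠ r i b := fun h => hab (by rw [(r i).injective h])
    exact (lt_or_gt_of_ne hne).imp (fun h => ⟨i, a, b, rfl, rfl, rfl, ha, hb, h⟩)
      (fun h => ⟨i, b, a, rfl, rfl, rfl, hb, ha, h⟩)

section ofPositions

variable {I : Type*} [Fintype I] {n : ℕ} {e : I ↪ 𝒱} {c : Fin n ↪ 𝒳}
  {r r' : I → Equiv.Perm (Fin n)} {A : Finset (Fin n)}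

theorem ofPositions_ranks {i : I} {a b : Fin n} :
    (ofPositions e c r A).ranks (e i) (c a) (c b) ↔ a ∈ A ∧ b ∈ A ∧ r i a < r i b := by
  constructor
  · rintro ⟨i', a', b', hi, ha, hb, h⟩
    rwa [e.injective hi, c.injective ha, c.injective hb] at h
  · rintro h
    exact ⟨i, a, b, rfl, rfl, rfl, h⟩

theorem ofPositions_congr
    (h : ∀ i, ∀ a ∈ A, ∀ b ∈ A, r i a < r i b ↔ r' i a < r' i b) :
    ofPositions e c r A = ofPositions e c r' A := by
  ext1
  · rfl
  · rfl
  · funext v x y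
    apply propext
    constructor
    · rintro ⟨i, a, b, hi, ha, hb, ha', hb', hr⟩
      exact ⟨i, a, b, hi, ha, hb, ha', hb', (h i a ha' b hb').1 hr⟩
    · rintro ⟨i, a, b, hi, ha, hb, ha', hb', hr⟩
      exact ⟨i, a, b, hi, ha, hb, ha', hb', (h i a ha' b hb').2 hr⟩

theorem ofPositions_restrict [DecidableEq 𝒳] (B : Finset (Fin n)) :
    (ofPositions e c r A).restrict (B.map c) = ofPositions e c r (A ∩ B) := by
  ext1
  · rfl
  · exact (Finset.map_inter A B).symm
  · funext v x y
    apply propext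
    constructor
    · rintro ⟨⟨i, a, b, hi, rfl, rfl, ha, hb, hr⟩, hx, hy⟩
      rw [Finset.mem_map'] at hx hy
      exact ⟨i, a, b, hi, rfl, rfl, Finset.mem_inter.2 ⟨ha, hx⟩, Finset.mem_inter.2 ⟨hb, hy⟩, hr⟩
    · rintro ⟨i, a, b, hi, rfl, rfl, ha, hb, hr⟩
      rw [Finset.mem_inter] at ha hb
      exact ⟨⟨i, a, b, hi, rfl, rfl, ha.1, hb.1, hr⟩, Finset.mem_map_of_mem c ha.2,
        Finset.mem_map_of_mem c hb.2⟩

theorem ofPositions_remove [DecidableEq 𝒳] (a : Fin n) :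
    (ofPositions e c r A).remove (c a) = ofPositions e c r (A.erase a) := by
  have : (A.map c).erase (c a) = (A.erase a).map c := (Finset.map_erase c A a).symm
  rw [remove, show (ofPositions e c r A).cands = A.map c from rfl, this, ofPositions_restrict,
    Finset.inter_eq_right.2 (Finset.erase_subset a A)]

theorem ofPositions_swapVoters [DecidableEq I] [DecidableEq 𝒱] (i j : I) :
    (ofPositions e c r A).swapVoters (e i) (e j) =
      ofPositions e c (fun k => r (Equiv.swap i j k)) A := by
  ext1
  · ext v
    change v ∈ (Finset.univ.map e).map _ ↔ v ∈ Finset.univ.map e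
    rw [Finset.mem_map_equiv, Equiv.symm_swap]
    simp only [Finset.mem_map, Finset.mem_univ, true_and]
    constructor
    · rintro ⟨k, hk⟩
      exact ⟨Equiv.swap i j k, by rw [← e.injective.swap_apply, hk, Equiv.swap_apply_self]⟩
    · rintro ⟨k, rfl⟩
      exact ⟨Equiv.swap i j k, (e.injective.swap_apply _ _ _).symm⟩
  · rfl
  · funext v x y
    apply propext
    constructor
    · rintro ⟨k, a, b, hk, ha, hb, ha', hb', hr⟩
      refine ⟨Equiv.swap i j k, a, b, ?_, ha, hb, ha', hb', by simpa using hr⟩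
      rw [← e.injective.swap_apply, hk, Equiv.swap_apply_self]
    · rintro ⟨k, a, b, rfl, ha, hb, ha', hb', hr⟩
      exact ⟨Equiv.swap i j k, a, b, (e.injective.swap_apply _ _ _).symm, ha, hb, ha', hb', hr⟩

theorem ofPositions_swapCands [DecidableEq 𝒳] (a b : Fin n) :
    (ofPositions e c r A).swapCands (c a) (c b) =
      ofPositions e c (fun k => r k * Equiv.swap a b) (A.map (Equiv.swap a b).toEmbedding) := by
  ext1
  · rfl
  · ext x
    change x ∈ (A.map c).map _ ↔ x ∈ (A.map _).map c
    simp only [Finset.mem_map, Equiv.coe_toEmbedding, exists_exists_and_eq_and,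
      c.injective.swap_apply]
  · funext v x y
    apply propext
    constructor
    · rintro ⟨k, p, q, hk, hp, hq, hp', hq', hr⟩
      refine ⟨k, Equiv.swap a b p, Equiv.swap a b q, hk, ?_, ?_, Finset.mem_map_of_mem _ hp',
        Finset.mem_map_of_mem _ hq', by simpa using hr⟩
      · rw [← c.injective.swap_apply, hp, Equiv.swap_apply_self]
      · rw [← c.injective.swap_apply, hq, Equiv.swap_apply_self]
    · rintro ⟨k, p, q, rfl, rfl, rfl, hp', hq', hr⟩
      rw [Finset.mem_map_equiv, Equiv.symm_swap] at hp' hq'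
      exact ⟨k, Equiv.swap a b p, Equiv.swap a b q, rfl, (c.injective.swap_apply _ _ _).symm,
        (c.injective.swap_apply _ _ _).symm, hp', hq', hr⟩

/-- The map `f` injects the voters preferring `b` into those preferring `a` and misses `i₀`, so the
latter are strictly more numerous. -/
theorem margin_ofPositions_ne_zero {a b : Fin n} (ha : a ∈ A) (hb : b ∈ A)
    (f : I → I) (hf : Function.Injective f) (h : ∀ i, r i b < r i a → r (f i) a < r (f i) b)
    (i₀ : I) (h₀ : r i₀ a < r i₀ b) (h₁ : ∀ i, r i b < r i a → f i ≠ i₀) :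
    (ofPositions e c r A).margin (c a) (c b) ≠ 0 := by
  classical
  have key : ∀ a b, a ∈ A → b ∈ A → ((ofPositions e c r A).voters.filter fun v =>
      (ofPositions e c r A).ranks v (c a) (c b)) = ((Finset.univ : Finset I).filter
        fun i => r i a < r i b).map e := by
    intro a b ha hb
    ext v
    simp only [Finset.mem_filter, Finset.mem_map, Finset.mem_univ, true_and]
    constructor
    · rintro ⟨-, i, a', b', rfl, ha', hb', -, -, hr⟩
      rw [c.injective ha', c.injective hb'] at hr
      exact ⟨i, hr, rfl⟩
    · rintro ⟨i, hr, rfl⟩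
      exact ⟨by simp [ofPositions], ofPositions_ranks.2 ⟨ha, hb, hr⟩⟩
  have lt : ((Finset.univ : Finset I).filter fun i => r i b < r i a).card <
      ((Finset.univ : Finset I).filter fun i => r i a < r i b).card := by
    rw [← Finset.card_image_of_injective _ hf]
    refine Finset.card_lt_card ⟨?_, fun hs => ?_⟩
    · intro j hj
      obtain ⟨i, hi, rfl⟩ := Finset.mem_image.1 hj
      simpa using h i (by simpa using hi)
    · obtain ⟨i, hi, hi'⟩ := Finset.mem_image.1 (hs (show i₀ ∈ _ by simpa using h₀))
      exact h₁ i (by simpa using hi) hi'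
  rw [margin]
  have e₁ := key a b ha hb
  have e₂ := key b a hb ha
  have : ((ofPositions e c r A).voters.filter fun v =>
      (ofPositions e c r A).ranks v (c b) (c a)).card < ((ofPositions e c r A).voters.filter fun v =>
      (ofPositions e c r A).ranks v (c a) (c b)).card := by
    rw [e₁, e₂, Finset.card_map, Finset.card_map]
    exact lt
  convert sub_ne_zero.2 (Nat.cast_injective.ne this.ne' : _ ≠ ((_ : ℕ) : ℤ)) using 4

end ofPositions

end Profile

/-! ### Realizing a tournament by majorities -/

section TournamentBallot

/-- The ranking in which the candidates have the positions given by `L`, except that the candidates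
at the first two positions are ordered as in `T`. -/
def tournamentBallot (T : Fin 6 → Fin 6 → Bool) (L : Equiv.Perm (Fin 6)) : Equiv.Perm (Fin 6) :=
  if T (L.symm 0) (L.symm 1) then L else Equiv.swap 0 1 * L

/-- Exchanging the adjacent positions 0 and 1 affects no comparison other than that between their
two occupants. -/
theorem tournamentBallot_lt_iff (T : Fin 6 → Fin 6 → Bool) (L : Equiv.Perm (Fin 6)) {a b : Fin 6}
    (h : ¬ ((L a = 0 ∧ L b = 1) ∨ (L a = 1 ∧ L b = 0))) :
    tournamentBallot T L a < tournamentBallot T L b ↔ L a < L b := by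
  have key : ∀ u v : Fin 6, ¬ ((u = 0 ∧ v = 1) ∨ (u = 1 ∧ v = 0)) →
    (Equiv.swap 0 1 u < Equiv.swap 0 1 v ↔ u < v) := by decide
  unfold tournamentBallot
  split_ifs
  · rfl
  · exact key _ _ h

theorem tournamentBallot_lt_of_edge {T : Fin 6 → Fin 6 → Bool} {L : Equiv.Perm (Fin 6)}
    {a b : Fin 6} (hab : T a b = true) (hba : T b a = false)
    (h : (L a = 0 ∧ L b = 1) ∨ (L a = 1 ∧ L b = 0)) :
    tournamentBallot T L a < tournamentBallot T L b := by
  unfold tournamentBallot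
  obtain ⟨h₀, h₁⟩ | ⟨h₁, h₀⟩ := h
  · have e₀ := (Equiv.symm_apply_eq L).2 h₀.symm
    have e₁ := (Equiv.symm_apply_eq L).2 h₁.symm
    rw [e₀, e₁, if_pos hab, h₀, h₁]
    decide
  · have e₀ := (Equiv.symm_apply_eq L).2 h₀.symm
    have e₁ := (Equiv.symm_apply_eq L).2 h₁.symm
    rw [e₀, e₁, hba, if_neg (by simp), Equiv.Perm.mul_apply, Equiv.Perm.mul_apply, h₀, h₁]
    decide

/-- Renaming candidates along an isomorphism on `A` turns the ballot of voter `L` into that of voter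
`L * σ`. This is what lets anonymity absorb the renaming. If the two top candidates are not both in
`A`, the top comparison is invisible on `A`, so nothing is needed there. -/
theorem tournamentBallot_relabel {T T' : Fin 6 → Fin 6 → Bool} {A : Finset (Fin 6)}
    {σ : Equiv.Perm (Fin 6)} (h : ∀ a ∈ A, ∀ b ∈ A, a ≠ b → T a b = T' (σ a) (σ b))
    (L : Equiv.Perm (Fin 6)) {a b : Fin 6} (ha : a ∈ A) (hb : b ∈ A) :
    tournamentBallot T' L (σ a) < tournamentBallot T' L (σ b) ↔
      tournamentBallot T (L * σ) a < tournamentBallot T (L * σ) b := by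
  by_cases hL : ((L * σ) a = 0 ∧ (L * σ) b = 1) ∨ ((L * σ) a = 1 ∧ (L * σ) b = 0)
  · have hab : a ≠ b := by
      rintro rfl
      obtain ⟨h₀, h₁⟩ | ⟨h₁, h₀⟩ := hL <;> rw [h₀] at h₁ <;> exact absurd h₁ (by decide)
    have e : T ((L * σ).symm 0) ((L * σ).symm 1) = T' (L.symm 0) (L.symm 1) := by
      obtain ⟨h₀, h₁⟩ | ⟨h₁, h₀⟩ := hL
      · rw [(Equiv.symm_apply_eq _).2 h₀.symm, (Equiv.symm_apply_eq _).2 h₁.symm, h _ ha _ hb hab,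
          ← h₀, ← h₁, Equiv.Perm.mul_apply, Equiv.Perm.mul_apply, L.symm_apply_apply,
          L.symm_apply_apply]
      · rw [(Equiv.symm_apply_eq _).2 h₀.symm, (Equiv.symm_apply_eq _).2 h₁.symm, h _ hb _ ha hab.symm,
          ← h₀, ← h₁, Equiv.Perm.mul_apply, Equiv.Perm.mul_apply, L.symm_apply_apply,
          L.symm_apply_apply]
    unfold tournamentBallot
    rw [e]
    split_ifs <;> rfl
  · rw [tournamentBallot_lt_iff T (L * σ) hL, tournamentBallot_lt_iff T' L hL]
    rfl

end TournamentBallot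

/-! ### From voting methods to choice from tournaments -/

namespace VotingMethod

variable {𝒳 : Type*} {𝒱 : Type*} {F : VotingMethod 𝒳 𝒱}

section ofPositions

variable {I : Type*} [Fintype I] {n : ℕ} {e : I ↪ 𝒱} {c : Fin n ↪ 𝒳}
  {A : Finset (Fin n)}

theorem ofPositions_mem_dom (hF : F.dom = profilesUpTo 𝒳 𝒱 n) (r : I → Equiv.Perm (Fin n))
    (hA : A.Nonempty) : Profile.ofPositions e c r A ∈ F.dom := by
  rw [hF]
  refine ⟨hA.map, ?_⟩
  change (A.map c).card ≤ n
  rw [Finset.card_map]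
  simpa using A.card_le_univ

/-- Transpositions generate all permutations of the finite index set, and each intermediate profile
stays in the domain. -/
theorem Anonymity.winners_comp [DecidableEq 𝒳] [DecidableEq 𝒱] [DecidableEq I]
    (h : F.Anonymity) (hF : F.dom = profilesUpTo 𝒳 𝒱 n)
    (hA : A.Nonempty) (π : Equiv.Perm I) (r : I → Equiv.Perm (Fin n)) :
    F.winners (Profile.ofPositions e c (fun i => r (π i)) A) =
      F.winners (Profile.ofPositions e c r A) := by
  induction π using Equiv.Perm.swap_induction_on generalizing r with
  | one => rfl
  | swap_mul π x y _ ih =>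
    rw [show (fun i => r ((Equiv.swap x y * π) i)) = fun i => (fun k => r (Equiv.swap x y k)) (π i)
      from rfl, ih (fun k => r (Equiv.swap x y k)), ← Profile.ofPositions_swapVoters]
    refine h _ (ofPositions_mem_dom hF r hA) _ _ ?_
    rw [Profile.ofPositions_swapVoters]
    exact ofPositions_mem_dom hF _ hA

/-- The same induction on transpositions, now on the candidate side, where ballots are composed on
the right. -/
theorem Neutrality.winners_mul [DecidableEq 𝒳] [DecidableEq 𝒱]
    (h : F.Neutrality) (hF : F.dom = profilesUpTo 𝒳 𝒱 n)
    (hA : A.Nonempty) (σ : Equiv.Perm (Fin n)) (r : I → Equiv.Perm (Fin n)) (a : Fin n) :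
    c (σ a) ∈ F.winners (Profile.ofPositions e c r (A.map σ.toEmbedding)) ↔
      c a ∈ F.winners (Profile.ofPositions e c (fun i => r i * σ) A) := by
  induction σ using Equiv.Perm.swap_induction_on generalizing r with
  | one =>
    have : A.map (1 : Equiv.Perm (Fin n)).toEmbedding = A := by
      ext; rw [Finset.mem_map_equiv]; rfl
    simp [this]
  | swap_mul π x y _ ih =>
    have key := h _ (ofPositions_mem_dom (e := e) (c := c) hF (fun i => r i * Equiv.swap x y)
      (hA.map (f := π.toEmbedding))) (c x) (c y) (by
        rw [Profile.ofPositions_swapCands]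
        exact ofPositions_mem_dom hF _ hA.map.map)
    rw [Profile.ofPositions_swapCands] at key
    have e₁ : (fun i => r i * Equiv.swap x y * Equiv.swap x y) = r := by
      funext i; rw [mul_assoc, Equiv.swap_mul_self, mul_one]
    have e₂ : A.map (Equiv.swap x y * π).toEmbedding =
        (A.map π.toEmbedding).map (Equiv.swap x y).toEmbedding := by
      rw [Finset.map_map]; rfl
    rw [e₁, ← e₂] at key
    rw [key, Finset.mem_map_equiv, Equiv.symm_swap, c.injective.swap_apply, Equiv.Perm.mul_apply,
      Equiv.swap_apply_self, ih]
    rfl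

end ofPositions

/-- There is no voting method for up to six candidates with the five axioms. -/
theorem not_exists_upTo_six [DecidableEq 𝒳] [DecidableEq 𝒱] [Infinite 𝒳] [Infinite 𝒱]
    (hF : F.dom = profilesUpTo 𝒳 𝒱 6)
    (anon : F.Anonymity) (neut : F.Neutrality) (bqr : F.BinaryQuasiResoluteness)
    (gamma : F.BinaryGamma) (alpha : F.AlphaResoluteness) : False := by
  classical
  let c : Fin 6 ↪ 𝒳 := Fin.valEmbedding.trans (Infinite.natEmbedding 𝒳)
  let e : Equiv.Perm (Fin 6) ↪ 𝒱 := (Fintype.equivFin _).toEmbedding.trans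
    (Fin.valEmbedding.trans (Infinite.natEmbedding 𝒱))
  let P : (Fin 6 → Fin 6 → Bool) → Finset (Fin 6) → Profile 𝒳 𝒱 := fun T A =>
    Profile.ofPositions e c (tournamentBallot T) A
  let W : (Fin 6 → Fin 6 → Bool) → Finset (Fin 6) → Finset (Fin 6) := fun T A =>
    A.filter fun a => c a ∈ F.winners (P T A)
  have dom : ∀ T A, A.Nonempty → P T A ∈ F.dom := fun T A hA => ofPositions_mem_dom hF _ hA
  have map_W : ∀ T A, A.Nonempty → F.winners (P T A) = (W T A).map c := by
    intro T A hA
    ext x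
    simp only [Finset.mem_map, W, Finset.mem_filter]
    constructor
    · intro hx
      obtain ⟨a, ha, rfl⟩ := Finset.mem_map.1 (F.winners_subset _ (dom T A hA) hx)
      exact ⟨a, ⟨ha, hx⟩, rfl⟩
    · rintro ⟨a, ⟨-, ha⟩, rfl⟩
      exact ha
  have iso : ∀ T T' A (σ : Equiv.Perm (Fin 6)), (∀ a ∈ A, ∀ b ∈ A, a ≠ b → T a b = T' (σ a) (σ b)) →
      W T' (A.map σ.toEmbedding) = (W T A).map σ.toEmbedding := by
    intro T T' A σ h
    have key : ∀ a ∈ A, c (σ a) ∈ F.winners (P T' (A.map σ.toEmbedding)) ↔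
        c a ∈ F.winners (P T A) := by
      intro a ha
      have hA : A.Nonempty := ⟨a, ha⟩
      rw [neut.winners_mul hF hA, ← anon.winners_comp hF hA (Equiv.mulRight σ)
        (tournamentBallot T), Profile.ofPositions_congr]
      intro L a ha b hb
      exact tournamentBallot_relabel h L ha hb
    ext a
    simp only [W, Finset.mem_filter, Finset.mem_map, Equiv.coe_toEmbedding]
    constructor
    · rintro ⟨⟨a, ha, rfl⟩, h⟩
      exact ⟨a, ⟨ha, (key a ha).1 h⟩, rfl⟩
    · rintro ⟨a, ⟨ha, h⟩, rfl⟩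
      exact ⟨⟨a, ha, rfl⟩, (key a ha).2 h⟩
  have rem : ∀ T A b, (P T A).remove (c b) = P T (A.erase b) := fun T A b =>
    Profile.ofPositions_remove b
  have pair : ∀ T A a b, a ∈ A → b ∈ A → (P T A).restrict {c a, c b} = P T {a, b} := by
    intro T A a b ha hb
    rw [show ({c a, c b} : Finset 𝒳) = ({a, b} : Finset (Fin 6)).map c by simp]
    rw [Profile.ofPositions_restrict, Finset.inter_eq_right.2]
    simp [Finset.insert_subset_iff, ha, hb]
  have ne : ∀ (T : Fin 6 → Fin 6 → Bool) a b, T a b = true → T b a = false → a ≠ b := by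
    rintro T a _ h₁ h₂ rfl
    rw [h₁] at h₂
    cases h₂
  have exists_perm : ∀ a b a' b' : Fin 6, a ≠ b → a' ≠ b' →
      ∃ σ : Equiv.Perm (Fin 6), σ a = a' ∧ σ b = b' := by
    intro a b a' b' h h'
    refine ⟨Equiv.swap (Equiv.swap a a' b) b' * Equiv.swap a a', ?_, by simp⟩
    rw [Equiv.Perm.mul_apply, Equiv.swap_apply_left, Equiv.swap_apply_of_ne_of_ne _ h']
    intro h''
    exact h ((Equiv.swap a a').injective (by rw [← h'', Equiv.swap_apply_left]))
  -- two candidates: exactly one of them wins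
  have card_pair : ∀ T a b, T a b = true → T b a = false → (W T {a, b}).card = 1 := by
    intro T a b h₁ h₂
    have hab := ne T a b h₁ h₂
    have hc : c a ≠ c b := fun h => hab (c.injective h)
    have hm : (P T {a, b}).margin (c a) (c b) ≠ 0 := by
      obtain ⟨L₀, hL₀⟩ : ∃ L : Equiv.Perm (Fin 6), L a = 0 ∧ L b = 1 := by
        obtain ⟨σ, h⟩ := exists_perm a b 0 1 hab (by decide)
        exact ⟨σ, h⟩
      -- Exchanging `a` and `b` in `L` matches each voter preferring `b` with one preferring `a`.
      -- The voter `L₀` is left over: its partner also has the pair on top and hence also prefers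
      -- `a`.
      refine Profile.margin_ofPositions_ne_zero (by simp) (by simp) (fun L => L * Equiv.swap a b)
        (mul_left_injective _) ?_ L₀ ?_ ?_
      · intro L hL
        have h : ¬ ((L a = 0 ∧ L b = 1) ∨ (L a = 1 ∧ L b = 0)) := fun h =>
          lt_asymm hL (tournamentBallot_lt_of_edge h₁ h₂ h)
        have h' : ¬ ((L b = 0 ∧ L a = 1) ∨ (L b = 1 ∧ L a = 0)) := fun h' =>
          h (h'.symm.imp And.symm And.symm)
        rw [tournamentBallot_lt_iff T L h'] at hL
        rw [tournamentBallot_lt_iff] <;>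
          simp only [Equiv.Perm.mul_apply, Equiv.swap_apply_left, Equiv.swap_apply_right]
        · exact hL
        · exact h'
      · exact tournamentBallot_lt_of_edge h₁ h₂ (Or.inl hL₀)
      · rintro L hL rfl
        simp only [Equiv.Perm.mul_apply, Equiv.swap_apply_left, Equiv.swap_apply_right] at hL₀
        exact lt_asymm hL (tournamentBallot_lt_of_edge h₁ h₂ (Or.inr hL₀.symm))
    have := bqr _ (dom T {a, b} ⟨a, by simp⟩) (by
      change (Finset.map c {a, b}).card = 2
      rw [Finset.card_map, Finset.card_pair hab]) (by
      have hneg : ∀ x y, (P T {a, b}).margin y x = - (P T {a, b}).margin x y := fun x y => by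
        rw [Profile.margin, Profile.margin]; ring
      intro x hx y hy hxy
      obtain ⟨x, hx', rfl⟩ := Finset.mem_map.1 hx
      obtain ⟨y, hy', rfl⟩ := Finset.mem_map.1 hy
      rw [Finset.mem_insert, Finset.mem_singleton] at hx' hy'
      obtain rfl | rfl := hx' <;> obtain rfl | rfl := hy'
      · exact absurd rfl hxy
      · exact hm
      · rw [hneg]; exact neg_ne_zero.2 hm
      · exact absurd rfl hxy)
    rwa [map_W _ _ ⟨a, by simp⟩, Finset.card_map] at this
  -- it suffices that the winner of each pair is the candidate who beats the other one
  have main : ∀ U : (Fin 6 → Fin 6 → Bool) → (Fin 6 → Fin 6 → Bool),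
      (∀ T T' (A : Finset (Fin 6)) (σ : Equiv.Perm (Fin 6)),
        (∀ a ∈ A, ∀ b ∈ A, a ≠ b → T a b = T' (σ a) (σ b)) →
        ∀ a ∈ A, ∀ b ∈ A, a ≠ b → U T a b = U T' (σ a) (σ b)) →
      (∀ T a b, T a b = true → T b a = false → W (U T) {a, b} = {a}) → False := by
    intro U hU hw
    refine no_equivariant_choice (fun T A => W (U T) A) ?_ ?_ ?_ ?_ ?_
    · intro T A hA
      have := F.winners_nonempty _ (dom (U T) A hA)
      rwa [map_W _ _ hA, Finset.map_nonempty] at this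
    · exact fun T A => Finset.filter_subset _ _
    · exact fun T T' A σ h => iso _ _ A σ (hU T T' A σ h)
    · intro T A a b hb ha h₁ h₂
      have hab := ne T a b h₁ h₂
      have haA := Finset.mem_of_mem_erase (Finset.mem_of_mem_filter _ ha)
      refine Finset.mem_filter.2 ⟨haA, gamma _ (dom _ A ⟨b, hb⟩) (c a) (c b) ?_ ?_ ?_ ?_⟩
      · rw [rem]; exact dom _ _ ⟨a, Finset.mem_of_mem_filter _ ha⟩
      · rw [pair _ _ _ _ haA hb]; exact dom _ _ ⟨a, by simp⟩
      · rw [rem]; exact (Finset.mem_filter.1 ha).2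
      · rw [pair _ _ _ _ haA hb, map_W _ _ ⟨a, by simp⟩, hw T a b h₁ h₂]; simp
    · intro T A a b hb ha h₁ h₂
      have hab := ne T a b h₁ h₂
      have haA := Finset.mem_of_mem_erase (Finset.mem_of_mem_filter _ ha)
      have := alpha _ (dom (U T) A ⟨b, hb⟩) (c a) (c b) ?_ ?_ ?_ ?_
      · rwa [rem, map_W _ _ ⟨b, hb⟩, map_W _ _ ⟨a, Finset.mem_of_mem_filter _ ha⟩,
          Finset.card_map, Finset.card_map] at this
      · rw [rem]; exact dom _ _ ⟨a, Finset.mem_of_mem_filter _ ha⟩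
      · rw [pair _ _ _ _ haA hb]; exact dom _ _ ⟨a, by simp⟩
      · rw [rem]; exact (Finset.mem_filter.1 ha).2
      · rw [pair _ _ _ _ haA hb, map_W _ _ ⟨a, by simp⟩, hw T a b h₁ h₂]; simp
  -- whether the stronger candidate wins does not depend on the pair
  have transport : ∀ T T' a b a' b', T a b = true → T b a = false → T' a' b' = true →
      T' b' a' = false → a ∈ W T {a, b} →
      a' ∈ W T' {a', b'} := by
    intro T T' a b a' b' h₁ h₂ h₁' h₂' ha
    obtain ⟨σ, rfl, rfl⟩ : ∃ σ : Equiv.Perm (Fin 6), σ a = a' ∧ σ b = b' := by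
      exact exists_perm a b a' b' (ne T a b h₁ h₂) (ne T' a' b' h₁' h₂')
    have := iso T T' {a, b} σ (by
      have hab := ne T a b h₁ h₂
      simp [h₁, h₂, h₁', h₂'])
    rw [show ({σ a, σ b} : Finset (Fin 6)) = ({a, b} : Finset (Fin 6)).map σ.toEmbedding by simp,
      this]
    exact Finset.mem_map_of_mem _ ha
  -- If the majority winner wins one pair, `transport` makes it win all pairs. Otherwise the
  -- majority loser always wins, and passing to the reversed relation restores the hypothesis of
  -- `main`.
  by_cases h : ∃ T a b, T a b = true ∧ T b a = false ∧ a ∈ W T {a, b}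
  · obtain ⟨T₀, a₀, b₀, h₁, h₂, h₀⟩ := h
    refine main (fun T => T) (fun T T' A σ h => h) fun T a b h₁' h₂' => ?_
    have ha := transport T₀ T a₀ b₀ a b h₁ h₂ h₁' h₂' h₀
    obtain ⟨x, hx⟩ := Finset.card_eq_one.1 (card_pair T a b h₁' h₂')
    rw [hx, Finset.mem_singleton] at ha
    rw [hx, ha]
  · refine main (fun T a b => T b a) (fun T T' A σ h a ha b hb hab => h b hb a ha hab.symm)
      fun T a b h₁ h₂ => ?_
    obtain ⟨x, hx⟩ := Finset.card_eq_one.1 (card_pair (fun a b => T b a) b a h₁ h₂)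
    have hxb : x ≠ b := by
      rintro rfl
      exact h ⟨_, x, a, h₁, h₂, by rw [hx]; simp⟩
    have : x ∈ ({b, a} : Finset (Fin 6)) :=
      Finset.filter_subset _ _ (hx ▸ Finset.mem_singleton_self x :
        x ∈ W (fun a b => T b a) {b, a})
    rw [Finset.mem_insert, Finset.mem_singleton, or_iff_right hxb] at this
    rw [Finset.pair_comm, hx, this]

end VotingMethod

/-! ### Finite tables of signs -/

section SignTables

/-- The digit of a sign in base three. -/
def SignType.digit : SignType → ℕ
  | .neg => 0
  | .zero => 1
  | .pos => 2

/-- Whether a sign is positive. -/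
def SignType.isPos : SignType → Bool
  | .pos => true
  | _ => false

/-- Whether a sign is negative. -/
def SignType.isNeg : SignType → Bool
  | .neg => true
  | _ => false

/-- Whether `x` is chosen from `{x, a, b}`: either `x` is undefeated, or the three candidates form
a cycle. The arguments are the signs of the margins of `x` over `a`, of `x` over `b` and of `a` over
`b`. -/
def winsThree (xa xb ab : SignType) : Bool :=
  (!xa.isNeg && !xb.isNeg) || (xa.isPos && xb.isNeg && ab.isPos) ||
    (xa.isNeg && xb.isPos && ab.isNeg)

/-- Whether `x` is chosen from `{x, a, b, c}`. The arguments are the signs of the margins between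
the four candidates; they form the base three expansion of the index of a bit. -/
def winsFour (xa xb xc ab ac bc : SignType) : Bool :=
  -- One bit for each of the 3^6 sign patterns. The proof uses only what is checked below:
  -- invariance under relabelling `a`, `b`, `c`, existence of a winner, and compatibility with the
  -- choices from three and from five.
  Nat.testBit
    0x1ffffffffffffff93c9e4ffffffffffffff4080007fc92496810000a020003fffffffffffff0008341ffffffc08102000000000182400000000000000001c0fff000106800022800003048000000000000002008200000000000000
    (((((xa.digit * 3 + xb.digit) * 3 + xc.digit) * 3 + ab.digit) * 3 + ac.digit) * 3 + bc.digit)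

/-- Whether `x` is chosen from some four of the candidates `x, a, b, c, d` and beats the fifth. -/
def winsFive (xa xb xc xd ab ac ad bc bd cd : SignType) : Bool :=
  (xa.isPos && winsFour xb xc xd bc bd cd) || (xb.isPos && winsFour xa xc xd ac ad cd) ||
    (xc.isPos && winsFour xa xb xd ab ad bd) || (xd.isPos && winsFour xa xb xc ab ac bc)

theorem winsThree_swap : ∀ xa xb ab : SignType, winsThree xb xa (-ab) = winsThree xa xb ab := by
  decide

/-- With `winsFour_swap_right`, this covers generators of the permutations of `a`, `b`, `c`, so the
table depends only on the set of opponents. -/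
theorem winsFour_swap_left : ∀ xa xb xc ab ac bc : SignType,
    winsFour xb xa xc (-ab) bc ac = winsFour xa xb xc ab ac bc := by
  decide +kernel

theorem winsFour_swap_right : ∀ xa xb xc ab ac bc : SignType,
    winsFour xa xc xb ac ab (-bc) = winsFour xa xb xc ab ac bc := by
  decide +kernel

theorem winsThree_exists : ∀ ab ac bc : SignType,
    winsThree ab ac bc || winsThree (-ab) bc ac || winsThree (-ac) (-bc) ab := by
  decide

theorem winsFour_exists : ∀ ab ac ad bc bd cd : SignType,
    winsFour ab ac ad bc bd cd || winsFour (-ab) bc bd ac ad cd ||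
      winsFour (-ac) (-bc) cd ab ad bd || winsFour (-ad) (-bd) (-cd) ab ac bc := by
  decide +kernel

/-- Binary `γ` and `α`-resoluteness for the passage from `{x, c}` to `{x, y, c}` with `x` beating
`y`; each summand is the indicator that one candidate wins. `winsFour_of_pos` is the analogue one
size up. -/
theorem winsThree_of_pos : ∀ xc yc : SignType, !xc.isNeg → winsThree 1 xc yc ∧
    (winsThree 1 xc yc).toNat + (winsThree (-1) yc xc).toNat + (winsThree (-xc) (-yc) 1).toNat ≤
      (!xc.isNeg).toNat + (!(-xc).isNeg).toNat := by
  decide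

theorem winsFour_of_pos : ∀ xc xd cd : SignType, winsThree xc xd cd → ∀ yc yd : SignType,
    winsFour 1 xc xd yc yd cd ∧
    (winsFour 1 xc xd yc yd cd).toNat + (winsFour (-1) yc yd xc xd cd).toNat +
        (winsFour (-xc) (-yc) cd 1 xd yd).toNat + (winsFour (-xd) (-yd) (-cd) 1 xc yc).toNat ≤
      (winsThree xc xd cd).toNat + (winsThree (-xc) cd xd).toNat +
        (winsThree (-xd) (-cd) xc).toNat := by
  decide +kernel

/-- Only the count has to be checked: binary `γ` is built into `winsFive`. This is the constraint
that the four-candidate table must meet to be extendable. -/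
theorem winsFive_of_pos : ∀ xc xd xe cd ce de : SignType, winsFour xc xd xe cd ce de →
    ∀ yc yd ye : SignType,
    (winsFive 1 xc xd xe yc yd ye cd ce de).toNat +
        (winsFive (-1) yc yd ye xc xd xe cd ce de).toNat +
        (winsFive (-xc) (-yc) cd ce 1 xd xe yd ye de).toNat +
        (winsFive (-xd) (-yd) (-cd) de 1 xc xe yc ye ce).toNat +
        (winsFive (-xe) (-ye) (-ce) (-de) 1 xc xd yc yd cd).toNat ≤
      (winsFour xc xd xe cd ce de).toNat + (winsFour (-xc) cd ce xd xe de).toNat +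
        (winsFour (-xd) (-cd) de xc xe ce).toNat + (winsFour (-xe) (-ce) (-de) xc xd cd).toNat := by
  decide +kernel

end SignTables

/-! ### The choice determined by the signs of the margins -/

section SignedChoice

variable {𝒳 : Type*}

/-- Whether `x` is chosen from `A`, which has at most four elements, given the signs `t` of the
margins. -/
def IsSmallWinner [DecidableEq 𝒳] (t : 𝒳 → 𝒳 → SignType) (A : Finset 𝒳) (x : 𝒳) : Prop :=
  A.card = 1 ∨
  (A.card = 2 ∧ ∃ a, A = {x, a} ∧ !(t x a).isNeg) ∨
  (A.card = 3 ∧ ∃ a b, A = {x, a, b} ∧ winsThree (t x a) (t x b) (t a b)) ∨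
  (A.card = 4 ∧ ∃ a b c, A = {x, a, b, c} ∧
    winsFour (t x a) (t x b) (t x c) (t a b) (t a c) (t b c))

open Classical in
/-- The choice from a set of at most four elements. -/
noncomputable def smallChoice (t : 𝒳 → 𝒳 → SignType) (A : Finset 𝒳) : Finset 𝒳 :=
  A.filter (IsSmallWinner t A)

open Classical in
/-- The elements of `A` that are chosen from a set `A \ {y}` and beat `y`. -/
noncomputable def inherited (t : 𝒳 → 𝒳 → SignType) (A : Finset 𝒳) : Finset 𝒳 :=
  A.filter fun x => ∃ y ∈ A, t x y = 1 ∧ x ∈ smallChoice t (A.erase y)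

open Classical in
/-- The choice from a set of at most five elements. -/
noncomputable def signedChoice (t : 𝒳 → 𝒳 → SignType) (A : Finset 𝒳) : Finset 𝒳 :=
  -- On five elements binary `γ` forces the inherited ones, and adding no others is best for
  -- `α`-resoluteness. If there are none, the premises of both axioms fail, and taking all of `A`
  -- respects symmetry.
  if A.card ≤ 4 then smallChoice t A else if (inherited t A).Nonempty then inherited t A else A

section Map

variable {t t' : 𝒳 → 𝒳 → SignType} {A : Finset 𝒳} {σ : Equiv.Perm 𝒳}

theorem IsSmallWinner.map [DecidableEq 𝒳] (h : ∀ x ∈ A, ∀ y ∈ A, t' (σ x) (σ y) = t x y) {x : 𝒳}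
    (hx : IsSmallWinner t A x) : IsSmallWinner t' (A.map σ.toEmbedding) (σ x) := by
  unfold IsSmallWinner at *
  rw [Finset.card_map]
  obtain hA | ⟨hA, a, rfl, hw⟩ | ⟨hA, a, b, rfl, hw⟩ | ⟨hA, a, b, c, rfl, hw⟩ := hx
  · exact Or.inl hA
  · refine Or.inr (Or.inl ⟨hA, σ a, by simp, ?_⟩)
    rwa [h] <;> simp
  · refine Or.inr (Or.inr (Or.inl ⟨hA, σ a, σ b, by simp, ?_⟩))
    rwa [h, h, h] <;> simp
  · refine Or.inr (Or.inr (Or.inr ⟨hA, σ a, σ b, σ c, by simp, ?_⟩))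
    rwa [h, h, h, h, h, h] <;> simp

theorem isSmallWinner_map_iff [DecidableEq 𝒳] (h : ∀ x ∈ A, ∀ y ∈ A, t' (σ x) (σ y) = t x y)
    {x : 𝒳} : IsSmallWinner t' (A.map σ.toEmbedding) (σ x) ↔ IsSmallWinner t A x := by
  refine ⟨fun hx => ?_, IsSmallWinner.map h⟩
  have := IsSmallWinner.map (t' := t) (σ := σ.symm) (by
    intro x hx y hy
    rw [Finset.mem_map_equiv] at hx hy
    rw [← h _ hx _ hy, σ.apply_symm_apply, σ.apply_symm_apply]) hx
  have e : (A.map σ.toEmbedding).map σ.symm.toEmbedding = A := by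
    ext; simp [Finset.mem_map_equiv]
  rwa [e, σ.symm_apply_apply] at this

theorem smallChoice_map (h : ∀ x ∈ A, ∀ y ∈ A, t' (σ x) (σ y) = t x y) :
    smallChoice t' (A.map σ.toEmbedding) = (smallChoice t A).map σ.toEmbedding := by
  classical
  ext x
  obtain ⟨x, rfl⟩ := σ.surjective x
  simp only [smallChoice, Finset.mem_filter, Finset.mem_map_equiv, σ.symm_apply_apply]
  exact and_congr_right fun _ => by convert isSmallWinner_map_iff h

theorem inherited_map (h : ∀ x ∈ A, ∀ y ∈ A, t' (σ x) (σ y) = t x y) :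
    inherited t' (A.map σ.toEmbedding) = (inherited t A).map σ.toEmbedding := by
  classical
  ext x
  obtain ⟨x, rfl⟩ := σ.surjective x
  simp only [inherited, Finset.mem_filter, Finset.mem_map_equiv, σ.symm_apply_apply]
  refine and_congr_right fun hx => ?_
  rw [σ.surjective.exists]
  refine exists_congr fun y => ?_
  rw [σ.symm_apply_apply]
  refine and_congr_right fun hy => ?_
  rw [h x hx y hy]
  refine and_congr_right fun _ => ?_
  have : (A.map σ.toEmbedding).erase (σ y) = (A.erase y).map σ.toEmbedding :=
    (Finset.map_erase σ.toEmbedding A y).symm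
  rw [this, smallChoice_map fun x hx y hy => h x (Finset.mem_of_mem_erase hx) y
    (Finset.mem_of_mem_erase hy), Finset.mem_map_equiv, σ.symm_apply_apply]

theorem signedChoice_map (h : ∀ x ∈ A, ∀ y ∈ A, t' (σ x) (σ y) = t x y) :
    signedChoice t' (A.map σ.toEmbedding) = (signedChoice t A).map σ.toEmbedding := by
  unfold signedChoice
  simp only [Finset.card_map, smallChoice_map h, inherited_map h, Finset.map_nonempty]
  split_ifs <;> rfl

theorem signedChoice_congr (h : ∀ x ∈ A, ∀ y ∈ A, t' x y = t x y) :
    signedChoice t' A = signedChoice t A := by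
  have := signedChoice_map (σ := 1) (t := t) (t' := t') h
  have e : ∀ B : Finset 𝒳, B.map (1 : Equiv.Perm 𝒳).toEmbedding = B := by
    intro B; ext; rw [Finset.mem_map_equiv]; rfl
  rwa [e, e] at this

end Map

theorem signedChoice_subset (t : 𝒳 → 𝒳 → SignType) (A : Finset 𝒳) : signedChoice t A ⊆ A := by
  classical
  unfold signedChoice
  split_ifs
  · exact Finset.filter_subset _ _
  · exact Finset.filter_subset _ _
  · exact subset_rfl

section Small

variable [DecidableEq 𝒳] {t : 𝒳 → 𝒳 → SignType} {x a b c d : 𝒳}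

theorem isSmallWinner_pair (h : x ≠ a) : IsSmallWinner t {x, a} x ↔ !(t x a).isNeg := by
  have hc : ({x, a} : Finset 𝒳).card = 2 := Finset.card_pair h
  unfold IsSmallWinner
  rw [hc]
  constructor
  · rintro (hA | ⟨-, a', hA, hw⟩ | ⟨hA, -⟩ | ⟨hA, -⟩)
    · omega
    · have : a ∈ ({x, a'} : Finset 𝒳) := by rw [← hA]; simp
      simp only [Finset.mem_insert, Finset.mem_singleton, h.symm, false_or] at this
      rwa [this]
    · omega
    · omega
  · exact fun hw => Or.inr (Or.inl ⟨rfl, a, rfl, hw⟩)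

theorem isSmallWinner_three (ht : ∀ x y, t y x = - t x y) (hxa : x ≠ a) (hxb : x ≠ b)
    (hab : a ≠ b) :
    IsSmallWinner t {x, a, b} x ↔ winsThree (t x a) (t x b) (t a b) := by
  have hc : ({x, a, b} : Finset 𝒳).card = 3 := Finset.card_eq_three.2 ⟨x, a, b, hxa, hxb, hab, rfl⟩
  unfold IsSmallWinner
  rw [hc]
  constructor
  · rintro (hA | ⟨hA, -⟩ | ⟨-, a', b', hA, hw⟩ | ⟨hA, -⟩)
    · omega
    · omega
    · have ha : a ∈ ({x, a', b'} : Finset 𝒳) := by rw [← hA]; simp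
      have hb : b ∈ ({x, a', b'} : Finset 𝒳) := by rw [← hA]; simp
      simp only [Finset.mem_insert, Finset.mem_singleton, hxa.symm, hxb.symm, false_or] at ha hb
      obtain rfl | rfl := ha <;> obtain rfl | rfl := hb
      · exact absurd rfl hab
      · exact hw
      · rwa [ht b a, winsThree_swap]
      · exact absurd rfl hab
    · omega
  · exact fun hw => Or.inr (Or.inr (Or.inl ⟨rfl, a, b, rfl, hw⟩))

theorem isSmallWinner_four (ht : ∀ x y, t y x = - t x y) (hxa : x ≠ a) (hxb : x ≠ b)
    (hxc : x ≠ c) (hab : a ≠ b) (hac : a ≠ c) (hbc : b ≠ c) :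
    IsSmallWinner t {x, a, b, c} x ↔
      winsFour (t x a) (t x b) (t x c) (t a b) (t a c) (t b c) := by
  have hc : ({x, a, b, c} : Finset 𝒳).card = 4 :=
    Finset.card_eq_four.2 ⟨x, a, b, c, hxa, hxb, hxc, hab, hac, hbc, rfl⟩
  unfold IsSmallWinner
  rw [hc]
  constructor
  · rintro (hA | ⟨hA, -⟩ | ⟨hA, -⟩ | ⟨-, a', b', c', hA, hw⟩)
    · omega
    · omega
    · omega
    · have ha : a ∈ ({x, a', b', c'} : Finset 𝒳) := by rw [← hA]; simp
      have hb : b ∈ ({x, a', b', c'} : Finset 𝒳) := by rw [← hA]; simp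
      have hc : c ∈ ({x, a', b', c'} : Finset 𝒳) := by rw [← hA]; simp
      simp only [Finset.mem_insert, Finset.mem_singleton, hxa.symm, hxb.symm, hxc.symm,
        false_or] at ha hb hc
      have sl : ∀ u v w : 𝒳, winsFour (t x u) (t x v) (t x w) (t u v) (t u w) (t v w) →
          winsFour (t x v) (t x u) (t x w) (t v u) (t v w) (t u w) := by
        intro u v w h
        rwa [ht u v, winsFour_swap_left]
      have sr : ∀ u v w : 𝒳, winsFour (t x u) (t x v) (t x w) (t u v) (t u w) (t v w) →
          winsFour (t x u) (t x w) (t x v) (t u w) (t u v) (t w v) := by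
        intro u v w h
        rwa [ht v w, winsFour_swap_right]
      -- The witnesses may list the three opponents in any of six orders; each is undone by adjacent
      -- exchanges.
      obtain rfl | rfl | rfl := ha <;> obtain rfl | rfl | rfl := hb <;>
        obtain rfl | rfl | rfl := hc <;> first
        | exact absurd rfl hab
        | exact absurd rfl hac
        | exact absurd rfl hbc
        | exact hw
        | exact sl _ _ _ hw
        | exact sr _ _ _ hw
        | exact sl _ _ _ (sr _ _ _ hw)
        | exact sr _ _ _ (sl _ _ _ hw)
        | exact sl _ _ _ (sr _ _ _ (sl _ _ _ hw))
  · exact fun hw => Or.inr (Or.inr (Or.inr ⟨rfl, a, b, c, rfl, hw⟩))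

theorem mem_smallChoice {A : Finset 𝒳} :
    x ∈ smallChoice t A ↔ x ∈ A ∧ IsSmallWinner t A x := by
  classical
  rw [smallChoice, Finset.mem_filter]
  exact and_congr_right fun _ => by convert Iff.rfl

open Classical in
theorem card_smallChoice (t : 𝒳 → 𝒳 → SignType) (A : Finset 𝒳) :
    (smallChoice t A).card = ∑ x ∈ A, if IsSmallWinner t A x then 1 else 0 := by
  rw [← Finset.card_filter]
  congr 1
  ext x
  rw [mem_smallChoice, Finset.mem_filter]

/-- Turns cardinalities, written as sums of indicators, into the Boolean sums that the sign tables
decide. -/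
theorem ite_eq_toNat {p : Prop} [Decidable p] {f : Bool} (h : p ↔ f) :
    (if p then 1 else 0) = f.toNat := by
  cases f <;> simp_all

theorem card_smallChoice_pair (ht : ∀ x y, t y x = - t x y) (hab : a ≠ b) :
    (smallChoice t {a, b}).card = (!(t a b).isNeg).toNat + (!(-t a b).isNeg).toNat := by
  classical
  rw [card_smallChoice, Finset.sum_pair hab, ite_eq_toNat (isSmallWinner_pair hab),
    ite_eq_toNat (by rw [Finset.pair_comm]; exact isSmallWinner_pair hab.symm), ← ht a b]

theorem card_smallChoice_three (ht : ∀ x y, t y x = - t x y) (hab : a ≠ b) (hac : a ≠ c)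
    (hbc : b ≠ c) :
    (smallChoice t {a, b, c}).card = (winsThree (t a b) (t a c) (t b c)).toNat +
      (winsThree (-t a b) (t b c) (t a c)).toNat +
      (winsThree (-t a c) (-t b c) (t a b)).toNat := by
  classical
  have e₁ : ({a, b, c} : Finset 𝒳) = {b, a, c} := Finset.insert_comm a b _
  have e₂ : ({a, b, c} : Finset 𝒳) = {c, a, b} := by grind
  rw [card_smallChoice, Finset.sum_insert (by simp [hab, hac]), Finset.sum_pair hbc,
    ite_eq_toNat (isSmallWinner_three ht hab hac hbc),
    ite_eq_toNat (by rw [e₁]; exact isSmallWinner_three ht hab.symm hbc hac),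
    ite_eq_toNat (by rw [e₂]; exact isSmallWinner_three ht hac.symm hbc.symm hab),
    ← ht a b, ← ht a c, ← ht b c, add_assoc]

theorem card_smallChoice_four (ht : ∀ x y, t y x = - t x y) (hab : a ≠ b) (hac : a ≠ c)
    (had : a ≠ d) (hbc : b ≠ c) (hbd : b ≠ d) (hcd : c ≠ d) :
    (smallChoice t {a, b, c, d}).card =
      (winsFour (t a b) (t a c) (t a d) (t b c) (t b d) (t c d)).toNat +
      (winsFour (-t a b) (t b c) (t b d) (t a c) (t a d) (t c d)).toNat +
      (winsFour (-t a c) (-t b c) (t c d) (t a b) (t a d) (t b d)).toNat +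
      (winsFour (-t a d) (-t b d) (-t c d) (t a b) (t a c) (t b c)).toNat := by
  classical
  have e₁ : ({a, b, c, d} : Finset 𝒳) = {b, a, c, d} := Finset.insert_comm a b _
  have e₂ : ({a, b, c, d} : Finset 𝒳) = {c, a, b, d} := by grind
  have e₃ : ({a, b, c, d} : Finset 𝒳) = {d, a, b, c} := by grind
  rw [card_smallChoice, Finset.sum_insert (by simp [hab, hac, had]),
    Finset.sum_insert (by simp [hbc, hbd]), Finset.sum_pair hcd,
    ite_eq_toNat (isSmallWinner_four ht hab hac had hbc hbd hcd),
    ite_eq_toNat (by rw [e₁]; exact isSmallWinner_four ht hab.symm hbc hbd hac had hcd),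
    ite_eq_toNat (by rw [e₂]; exact isSmallWinner_four ht hac.symm hbc.symm hcd hab had hbd),
    ite_eq_toNat (by rw [e₃]; exact isSmallWinner_four ht had.symm hbd.symm hcd.symm hab hac hbc),
    ← ht a b, ← ht a c, ← ht b c, ← ht a d, ← ht b d, ← ht c d, add_assoc, add_assoc]

theorem mem_inherited {A : Finset 𝒳} :
    x ∈ inherited t A ↔ x ∈ A ∧ ∃ y ∈ A, t x y = 1 ∧ x ∈ smallChoice t (A.erase y) := by
  simp only [inherited, Finset.mem_filter]
  exact and_congr_right fun _ => by convert Iff.rfl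

theorem isPos_iff : ∀ {s : SignType}, s.isPos ↔ s = 1 := by decide

/-- The set is a variable `A` with an equation, so that counting over one fixed `A` can put each of
its five elements in front in turn. -/
theorem mem_inherited_five (ht : ∀ x y, t y x = - t x y) (hxa : x ≠ a) (hxb : x ≠ b) (hxc : x ≠ c)
    (hxd : x ≠ d) (hab : a ≠ b) (hac : a ≠ c) (had : a ≠ d) (hbc : b ≠ c) (hbd : b ≠ d)
    (hcd : c ≠ d) {A : Finset 𝒳} (hA : A = {x, a, b, c, d}) :
    (∃ y ∈ A, t x y = 1 ∧ x ∈ smallChoice t (A.erase y)) ↔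
      winsFive (t x a) (t x b) (t x c) (t x d) (t a b) (t a c) (t a d) (t b c) (t b d) (t c d) := by
  subst hA
  have ea : ({x, a, b, c, d} : Finset 𝒳).erase a = {x, b, c, d} := by grind
  have eb : ({x, a, b, c, d} : Finset 𝒳).erase b = {x, a, c, d} := by grind
  have ec : ({x, a, b, c, d} : Finset 𝒳).erase c = {x, a, b, d} := by grind
  have ed : ({x, a, b, c, d} : Finset 𝒳).erase d = {x, a, b, c} := by grind
  have hx : ∀ B : Finset 𝒳, x ∈ smallChoice t (insert x B) ↔ IsSmallWinner t (insert x B) x :=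
    fun B => by rw [mem_smallChoice]; exact and_iff_right (Finset.mem_insert_self _ _)
  have hxx : ¬ (t x x = 1 ∧ x ∈ smallChoice t (({x, a, b, c, d} : Finset 𝒳).erase x)) := by
    rintro ⟨-, h⟩
    exact Finset.notMem_erase _ _ (mem_smallChoice.1 h).1
  simp only [Finset.exists_mem_insert, Finset.mem_singleton, exists_eq_left, hxx, false_or, ea, eb,
    ec, ed, hx, isSmallWinner_four ht hxb hxc hxd hbc hbd hcd,
    isSmallWinner_four ht hxa hxc hxd hac had hcd, isSmallWinner_four ht hxa hxb hxd hab had hbd,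
    isSmallWinner_four ht hxa hxb hxc hab hac hbc, winsFive, Bool.or_eq_true, Bool.and_eq_true,
    isPos_iff, or_assoc]

end Small

/-! ### Verification of the axioms for the signed choice -/

section Axioms

variable [DecidableEq 𝒳] {t : 𝒳 → 𝒳 → SignType} {A : Finset 𝒳} {x y : 𝒳}

theorem card_inherited_five (ht : ∀ x y, t y x = - t x y) {a b c d e : 𝒳} (hab : a ≠ b)
    (hac : a ≠ c) (had : a ≠ d) (hae : a ≠ e) (hbc : b ≠ c) (hbd : b ≠ d) (hbe : b ≠ e)
    (hcd : c ≠ d) (hce : c ≠ e) (hde : d ≠ e) (hA : A = {a, b, c, d, e}) :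
    (inherited t A).card =
      (winsFive (t a b) (t a c) (t a d) (t a e) (t b c) (t b d) (t b e) (t c d) (t c e)
        (t d e)).toNat +
      (winsFive (-t a b) (t b c) (t b d) (t b e) (t a c) (t a d) (t a e) (t c d) (t c e)
        (t d e)).toNat +
      (winsFive (-t a c) (-t b c) (t c d) (t c e) (t a b) (t a d) (t a e) (t b d) (t b e)
        (t d e)).toNat +
      (winsFive (-t a d) (-t b d) (-t c d) (t d e) (t a b) (t a c) (t a e) (t b c) (t b e)
        (t c e)).toNat +
      (winsFive (-t a e) (-t b e) (-t c e) (-t d e) (t a b) (t a c) (t a d) (t b c) (t b d)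
        (t c d)).toNat := by
  classical
  have e₁ : A = {b, a, c, d, e} := by grind
  have e₂ : A = {c, a, b, d, e} := by grind
  have e₃ : A = {d, a, b, c, e} := by grind
  have e₄ : A = {e, a, b, c, d} := by grind
  have key : (inherited t A).card =
      ∑ x ∈ A, if ∃ y ∈ A, t x y = 1 ∧ x ∈ smallChoice t (A.erase y) then 1 else 0 := by
    rw [← Finset.card_filter]
    congr 1
    ext x
    simp only [mem_inherited, Finset.mem_filter]
  have sum : ∀ f : 𝒳 → ℕ, ∑ x ∈ A, f x = f a + f b + f c + f d + f e := by
    intro f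
    rw [hA, Finset.sum_insert (by simp [*]), Finset.sum_insert (by simp [*]),
      Finset.sum_insert (by simp [*]), Finset.sum_pair hde, add_assoc, add_assoc, add_assoc]
  rw [key, sum, ite_eq_toNat (mem_inherited_five ht hab hac had hae hbc hbd hbe hcd hce hde hA),
    ite_eq_toNat (mem_inherited_five ht hab.symm hbc hbd hbe hac had hae hcd hce hde e₁),
    ite_eq_toNat (mem_inherited_five ht hac.symm hbc.symm hcd hce hab had hae hbd hbe hde e₂),
    ite_eq_toNat (mem_inherited_five ht had.symm hbd.symm hcd.symm hde hab hac hae hbc hbe hce e₃),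
    ite_eq_toNat (mem_inherited_five ht hae.symm hbe.symm hce.symm hde.symm hab hac had hbc hbd hcd
      e₄),
    ← ht a b, ← ht a c, ← ht a d, ← ht a e, ← ht b c, ← ht b d, ← ht b e, ← ht c d, ← ht c e,
    ← ht d e]

theorem smallChoice_nonempty (ht : ∀ x y, t y x = - t x y) (hA : A.Nonempty) (h : A.card ≤ 4) :
    (smallChoice t A).Nonempty := by
  rw [← Finset.card_pos]
  have h₀ := hA.card_pos
  obtain h | h | h | h : A.card = 1 ∨ A.card = 2 ∨ A.card = 3 ∨ A.card = 4 := by omega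
  · obtain ⟨x, hx⟩ := hA
    exact Finset.card_pos.2 ⟨x, mem_smallChoice.2 ⟨hx, Or.inl h⟩⟩
  · obtain ⟨a, b, hab, rfl⟩ := Finset.card_eq_two.1 h
    rw [card_smallChoice_pair ht hab]
    generalize t a b = s
    revert s
    decide
  · obtain ⟨a, b, c, hab, hac, hbc, rfl⟩ := Finset.card_eq_three.1 h
    rw [card_smallChoice_three ht hab hac hbc]
    have := winsThree_exists (t a b) (t a c) (t b c)
    simp only [Bool.or_eq_true] at this
    obtain (h | h) | h := this <;> rw [h, Bool.toNat_true] <;> omega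
  · obtain ⟨a, b, c, d, hab, hac, had, hbc, hbd, hcd, rfl⟩ := Finset.card_eq_four.1 h
    rw [card_smallChoice_four ht hab hac had hbc hbd hcd]
    have := winsFour_exists (t a b) (t a c) (t a d) (t b c) (t b d) (t c d)
    simp only [Bool.or_eq_true] at this
    obtain ((h | h) | h) | h := this <;> rw [h, Bool.toNat_true] <;> omega

theorem signedChoice_nonempty (ht : ∀ x y, t y x = - t x y) (hA : A.Nonempty) :
    (signedChoice t A).Nonempty := by
  unfold signedChoice
  split_ifs with h h'
  · exact smallChoice_nonempty ht hA h
  · exact h'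
  · exact hA

theorem signedChoice_pair_eq_singleton (ht : ∀ x y, t y x = - t x y) (hxy : x ≠ y) :
    signedChoice t {x, y} = {x} ↔ t x y = 1 := by
  have hc : ({x, y} : Finset 𝒳).card ≤ 4 := by rw [Finset.card_pair hxy]; omega
  have hx : x ∈ smallChoice t {x, y} ↔ !(t x y).isNeg := by
    rw [mem_smallChoice, isSmallWinner_pair hxy]; simp
  have hy : y ∈ smallChoice t {x, y} ↔ !(-t x y).isNeg := by
    rw [mem_smallChoice, Finset.pair_comm, isSmallWinner_pair hxy.symm, ht x y]; simp
  have hs : ∀ z ∈ smallChoice t {x, y}, z = x ∨ z = y := fun z hz => by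
    simpa using (mem_smallChoice.1 hz).1
  rw [signedChoice, if_pos hc]
  constructor
  · intro h
    rw [h, Finset.mem_singleton] at hx hy
    have h₁ := hx.1 rfl
    have h₂ : ¬ (!(-t x y).isNeg) = true := fun h => hxy (hy.2 h).symm
    revert h₁ h₂
    generalize t x y = s
    revert s
    decide
  · intro h
    rw [h] at hx hy
    ext z
    rw [Finset.mem_singleton]
    constructor
    · intro hz
      obtain rfl | rfl := hs z hz
      · rfl
      · exact absurd (hy.1 hz) (by decide)
    · rintro rfl
      exact hx.2 (by decide)

/-- `signedChoice` satisfies binary `γ` and `α`-resoluteness. -/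
theorem signedChoice_of_erase (ht : ∀ x y, t y x = - t x y) (hA : A.card ≤ 5) (hy : y ∈ A)
    (hx : x ∈ signedChoice t (A.erase y)) (hxy : t x y = 1) :
    x ∈ signedChoice t A ∧ (signedChoice t A).card ≤ (signedChoice t (A.erase y)).card := by
  have hxA := signedChoice_subset _ _ hx
  have hne := Finset.ne_of_mem_erase hxA
  -- `B` consists of the bystanders; its size, from 0 to 3, selects the table lemma to apply.
  obtain ⟨B, hB⟩ : ∃ B, B = (A.erase y).erase x := ⟨_, rfl⟩
  have hxB : x ∉ B := by grind
  have hyB : y ∉ B := by grind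
  have hAy : A.erase y = insert x B := by rw [hB, Finset.insert_erase hxA]
  have hAB : A = insert x (insert y B) := by
    rw [Finset.insert_comm, ← hAy, Finset.insert_erase hy]
  have hc : A.card = B.card + 2 := by
    rw [hAB, Finset.card_insert_of_notMem (by simp [hne, hxB]), Finset.card_insert_of_notMem hyB]
  have hc' : (A.erase y).card = B.card + 1 := by rw [Finset.card_erase_of_mem hy, hc]; rfl
  rw [hAy] at hx hc' ⊢
  have hs : signedChoice t (insert x B) = smallChoice t (insert x B) := if_pos (by omega)
  rw [hs] at hx ⊢
  have hx' := hx
  rw [mem_smallChoice] at hx'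
  replace hx' := hx'.2
  obtain h | h | h | h : B.card = 0 ∨ B.card = 1 ∨ B.card = 2 ∨ B.card = 3 := by omega
  · obtain rfl := Finset.card_eq_zero.1 h
    rw [show signedChoice t A = {x} by
      rw [hAB]; exact (signedChoice_pair_eq_singleton ht hne).2 hxy]
    exact ⟨Finset.mem_singleton_self x, Finset.card_pos.2 ⟨x, hx⟩⟩
  · obtain ⟨c, rfl⟩ := Finset.card_eq_one.1 h
    rw [Finset.mem_singleton] at hxB hyB
    rw [isSmallWinner_pair hxB] at hx'
    have key := winsThree_of_pos _ (t y c) hx'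
    rw [show signedChoice t A = smallChoice t A from if_pos (by omega), hAB, mem_smallChoice,
      isSmallWinner_three ht hne hxB hyB, card_smallChoice_three ht hne hxB hyB,
      card_smallChoice_pair ht hxB, hxy]
    exact ⟨⟨by simp, key.1⟩, key.2⟩
  · obtain ⟨c, d, hcd, rfl⟩ := Finset.card_eq_two.1 h
    simp only [Finset.mem_insert, Finset.mem_singleton, not_or] at hxB hyB
    obtain ⟨hxc, hxd⟩ := hxB
    obtain ⟨hyc, hyd⟩ := hyB
    rw [isSmallWinner_three ht hxc hxd hcd] at hx'
    have key := winsFour_of_pos _ _ _ hx' (t y c) (t y d)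
    rw [show signedChoice t A = smallChoice t A from if_pos (by omega), hAB, mem_smallChoice,
      isSmallWinner_four ht hne hxc hxd hyc hyd hcd,
      card_smallChoice_four ht hne hxc hxd hyc hyd hcd,
      card_smallChoice_three ht hxc hxd hcd, hxy]
    exact ⟨⟨by simp, key.1⟩, key.2⟩
  · have hxi : x ∈ inherited t A :=
      mem_inherited.2 ⟨by rw [hAB]; simp, y, hy, hxy, by rwa [hAy]⟩
    have hs : signedChoice t A = inherited t A := by
      rw [signedChoice, if_neg (by omega), if_pos ⟨x, hxi⟩]
    rw [hs]
    refine ⟨hxi, ?_⟩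
    obtain ⟨c, d, e, hcd, hce, hde, rfl⟩ := Finset.card_eq_three.1 h
    simp only [Finset.mem_insert, Finset.mem_singleton, not_or] at hxB hyB
    obtain ⟨hxc, hxd, hxe⟩ := hxB
    obtain ⟨hyc, hyd, hye⟩ := hyB
    rw [isSmallWinner_four ht hxc hxd hxe hcd hce hde] at hx'
    rw [card_inherited_five ht hne hxc hxd hxe hyc hyd hye hcd hce hde hAB,
      card_smallChoice_four ht hxc hxd hxe hcd hce hde, hxy]
    exact winsFive_of_pos _ _ _ _ _ _ hx' (t y c) (t y d) (t y e)

end Axioms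

end SignedChoice

/-! ### Margin signs and the method for five candidates -/

namespace Profile

variable {𝒳 : Type*} {𝒱 : Type*}

theorem margin_swap (P : Profile 𝒳 𝒱) (x y : 𝒳) : P.margin y x = - P.margin x y := by
  rw [margin, margin]; ring

/-- The sign of the margin of `x` over `y`. -/
noncomputable def marginSign (P : Profile 𝒳 𝒱) (x y : 𝒳) : SignType :=
  SignType.sign (P.margin x y)

theorem marginSign_swap (P : Profile 𝒳 𝒱) (x y : 𝒳) : P.marginSign y x = - P.marginSign x y := by
  rw [marginSign, marginSign, margin_swap, Left.sign_neg]

/-- A bijection of voters that preserves the comparison in both directions preserves the margin;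
restriction and both kinds of renaming are instances. -/
theorem marginSign_congr {P Q : Profile 𝒳 𝒱} (e : Equiv.Perm 𝒱) {x y x' y' : 𝒳}
    (hv : ∀ i, i ∈ P.voters ↔ e i ∈ Q.voters)
    (h : ∀ i, P.ranks i x y ↔ Q.ranks (e i) x' y')
    (h' : ∀ i, P.ranks i y x ↔ Q.ranks (e i) y' x') : P.marginSign x y = Q.marginSign x' y' := by
  rw [marginSign, marginSign, margin, margin]
  congr 3 <;> refine Finset.card_equiv e fun i => ?_
  · simp only [Finset.mem_filter, hv, h]
  · simp only [Finset.mem_filter, hv, h']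

theorem marginSign_restrict [DecidableEq 𝒳] (P : Profile 𝒳 𝒱) {A : Finset 𝒳} {x y : 𝒳}
    (hx : x ∈ A) (hy : y ∈ A) : (P.restrict A).marginSign x y = P.marginSign x y :=
  marginSign_congr 1 (fun _ => Iff.rfl) (fun _ => and_iff_left ⟨hx, hy⟩)
    (fun _ => and_iff_left ⟨hy, hx⟩)

theorem marginSign_swapVoters [DecidableEq 𝒱] (P : Profile 𝒳 𝒱) (i j : 𝒱) (x y : 𝒳) :
    (P.swapVoters i j).marginSign x y = P.marginSign x y :=
  marginSign_congr (Equiv.swap i j) (fun _ => by rw [swapVoters, Finset.mem_map_equiv,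
    Equiv.symm_swap]) (fun _ => Iff.rfl) (fun _ => Iff.rfl)

theorem marginSign_swapCands [DecidableEq 𝒳] (P : Profile 𝒳 𝒱) (a b x y : 𝒳) :
    (P.swapCands a b).marginSign (Equiv.swap a b x) (Equiv.swap a b y) = P.marginSign x y := by
  refine marginSign_congr 1 (fun _ => Iff.rfl) ?_ ?_ <;> intro i <;>
    simp only [swapCands, Equiv.swap_apply_self, Equiv.Perm.one_apply]

end Profile

section UpToFive

variable {𝒳 : Type*} {𝒱 : Type*}

/-- The voting method for up to five candidates given by `signedChoice`. -/
noncomputable def signedMethod (𝒳 𝒱 : Type*) [Nonempty 𝒳] : VotingMethod 𝒳 𝒱 where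
  dom := profilesUpTo 𝒳 𝒱 5
  dom_nonempty := by
    classical
    obtain ⟨x⟩ := ‹Nonempty 𝒳›
    exact ⟨⟨∅, {x}, fun _ _ _ => False, by simp, by simp, by simp, by simp⟩, by simp [profilesUpTo]⟩
  winners P := signedChoice P.marginSign P.cands
  winners_nonempty P hP := by
    classical
    exact signedChoice_nonempty P.marginSign_swap hP.1
  winners_subset P _ := signedChoice_subset _ _

theorem signedMethod_anonymity [Nonempty 𝒳] [DecidableEq 𝒱] : (signedMethod 𝒳 𝒱).Anonymity := by
  intro P _ i j _
  exact signedChoice_congr fun x _ y _ => P.marginSign_swapVoters i j x y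

theorem signedMethod_neutrality [Nonempty 𝒳] [DecidableEq 𝒳] : (signedMethod 𝒳 𝒱).Neutrality := by
  intro P _ a b _
  exact signedChoice_map fun x _ y _ => P.marginSign_swapCands a b x y

theorem signedMethod_winners_restrict [Nonempty 𝒳] [DecidableEq 𝒳] (P : Profile 𝒳 𝒱)
    {A : Finset 𝒳} (hA : A ⊆ P.cands) :
    (signedMethod 𝒳 𝒱).winners (P.restrict A) = signedChoice P.marginSign A := by
  change signedChoice _ (P.cands ∩ A) = _
  rw [Finset.inter_eq_right.2 hA]
  exact signedChoice_congr fun x hx y hy => P.marginSign_restrict hx hy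

theorem signedMethod_binaryQuasiResoluteness [Nonempty 𝒳] [DecidableEq 𝒳] :
    (signedMethod 𝒳 𝒱).BinaryQuasiResoluteness := by
  intro P _ hc hm
  obtain ⟨x, y, hxy, h⟩ := Finset.card_eq_two.1 hc
  have hm := hm x (by simp [h]) y (by simp [h]) hxy
  change (signedChoice _ P.cands).card = 1
  rw [h]
  obtain hm | hm := lt_or_gt_of_ne hm
  · rw [Finset.pair_comm, (signedChoice_pair_eq_singleton P.marginSign_swap hxy.symm).2,
      Finset.card_singleton]
    rw [Profile.marginSign, Profile.margin_swap, sign_pos (by omega)]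
  · rw [(signedChoice_pair_eq_singleton P.marginSign_swap hxy).2 (sign_pos hm),
      Finset.card_singleton]

theorem signedMethod_of_remove [Nonempty 𝒳] [DecidableEq 𝒳] {P : Profile 𝒳 𝒱}
    (hP : P ∈ profilesUpTo 𝒳 𝒱 5)
    {x y : 𝒳} (hx : x ∈ (signedMethod 𝒳 𝒱).winners (P.remove y))
    (hxy : (signedMethod 𝒳 𝒱).winners (P.restrict {x, y}) = {x}) :
    x ∈ (signedMethod 𝒳 𝒱).winners P ∧ ((signedMethod 𝒳 𝒱).winners P).card ≤
      ((signedMethod 𝒳 𝒱).winners (P.remove y)).card := by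
  rw [Profile.remove, signedMethod_winners_restrict P (Finset.erase_subset y _)] at hx ⊢
  by_cases hy : y ∈ P.cands
  · have hx' := signedChoice_subset _ _ hx
    have hne := Finset.ne_of_mem_erase hx'
    rw [signedMethod_winners_restrict P (by
      simp [Finset.insert_subset_iff, Finset.mem_of_mem_erase hx', hy]),
      signedChoice_pair_eq_singleton P.marginSign_swap hne] at hxy
    exact signedChoice_of_erase P.marginSign_swap hP.2 hy hx hxy
  -- The axioms also allow `y` outside the profile; removing it then changes nothing.
  · rw [Finset.erase_eq_of_notMem hy] at hx ⊢
    exact ⟨hx, le_rfl⟩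

end UpToFive

theorem mainTheorem1 {𝒳 : Type*} {𝒱 : Type*} [Infinite 𝒳] [Infinite 𝒱]
    [DecidableEq 𝒳] [DecidableEq 𝒱] :
    (¬ ∃ F : VotingMethod 𝒳 𝒱, F.dom = profilesUpTo 𝒳 𝒱 6 ∧ F.Anonymity ∧ F.Neutrality ∧
        F.BinaryQuasiResoluteness ∧ F.BinaryGamma ∧ F.AlphaResoluteness) ∧
      (∃ F : VotingMethod 𝒳 𝒱, F.dom = profilesUpTo 𝒳 𝒱 5 ∧ F.Anonymity ∧ F.Neutrality ∧
        F.BinaryQuasiResoluteness ∧ F.BinaryGamma ∧ F.AlphaResoluteness) := by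
  constructor
  · rintro ⟨F, hF, anon, neut, bqr, gamma, alpha⟩
    exact F.not_exists_upTo_six hF anon neut bqr gamma alpha
  · exact ⟨signedMethod 𝒳 𝒱, rfl, signedMethod_anonymity, signedMethod_neutrality,
      signedMethod_binaryQuasiResoluteness,
      fun P hP x y _ _ hx hxy => (signedMethod_of_remove hP hx hxy).1,
      fun P hP x y _ _ hx hxy => (signedMethod_of_remove hP hx hxy).2⟩
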